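/- Let $n<m$ be natural numbers, let $2\le k\le\infty$, $T\ge 0$, let $\mathcal X\subset\mathbb R^n$, $\Omega_t\subset\mathbb R$ and $\Omega_h\subset\mathbb R^m$ be open, and let $f\in C^{0,k}(\Omega_t\times\Omega_h,\mathbb R^m)$, i.e. $f(t,y)$ is $k$ times differentiable in $y$, and $f$ and all its derivatives with respect to $y$ of (finite) order at most $k$ are continuous in $(t,y)$. For $a\in\Omega_h$ let $h_a:\mathcal I_a\to\Omega_h$ denote the solution of $h'(t)=f(t,h(t))$, $h(0)=a$, on its maximal interval of existence $\mathcal I_a\subset\Omega_t$. For weights and biases $V=(W,\widetilde W,b,\tilde b)\in\mathbb V:=\mathbb R^{m\times n}\times\mathbb R^{1\times m}\times\mathbb R^m\times\mathbb R$ put $\lambda(x)=Wx+b$. We say that $V$ defines an augmented scalar neural ODE if $\operatorname{rank}W=n$, $\operatorname{rank}\widetilde W=1$, $\lambda(\mathcal X)\subset\Omega_h$, and $[0,T]\subset\mathcal I_a$ for all $a\in\lambda(\mathcal X)$; the neural ODE is then the map $$\Phi_V:\mathcal X\to\mathbb R,\qquad \Phi_V(x)=\widetilde W\,h_{Wx+b}(T)+\tilde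 b .$$ Identify $\mathbb V$ with $\mathbb R^{N_V}$, $N_V=mn+2m+1$, by listing all entries. Then there is a Lebesgue null set $N\subset\mathbb R^{N_V}$ such that, for every $V$ outside $N$ that defines an augmented scalar neural ODE, $\Phi_V$ is of class $(\mathcal C1)^k(\mathcal X,\mathbb R)$ or $(\mathcal C2)^k(\mathcal X,\mathbb R)$, and hence a Morse function. Here $(\mathcal C1)^k(\mathcal X,\mathbb R)$ is the set of all $\Phi\in C^k(\mathcal X,\mathbb R)$ with $\nabla\Phi(x)\ne0$ for all $x\in\mathcal X$; $(\mathcal C2)^k(\mathcal X,\mathbb R)$ is the set of all $\Phi\in C^k(\mathcal X,\mathbb R)$ that have at least one critical point and whose Hessian matrix is non-singular at every critical point; and a Morse function is a $\Phi\in C^2(\mathcal X,\mathbb R)$ whose Hessian matrix is non-singular at every critical point. -/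

import Mathlib

open Set MeasureTheory

noncomputable section

namespace NeuralODE

/-- `ℝⁿ` with its Euclidean structure. -/
abbrev E (n : ℕ) : Type := EuclideanSpace ℝ (Fin n)

/-! ### Critical points, Morse functions and the classes `(C1)^k`, `(C2)^k`

All notions concern a map on an open set `X ⊆ ℝⁿ`; it is written as a function on `ℝⁿ` of which
only the values on `X` matter. -/

/-- The Hessian matrix `H_Φ(p)` of second partial derivatives. -/
def hessian {n : ℕ} (Φ : E n → ℝ) (p : E n) : Matrix (Fin n) (Fin n) ℝ :=
  Matrix.of fun i j =>
    fderiv ℝ (fun y => fderiv ℝ Φ y (EuclideanSpace.single j 1)) p (EuclideanSpace.single i 1)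

/-- `p` is a critical point of `Φ : X → ℝ`. -/
def IsCriticalPoint {n : ℕ} (X : Set (E n)) (Φ : E n → ℝ) (p : E n) : Prop :=
  p ∈ X ∧ gradient Φ p = 0

/-- `Φ ∈ C²(X, ℝ)` and every critical point of `Φ` in `X` has a non-singular Hessian. -/
def IsMorse {n : ℕ} (X : Set (E n)) (Φ : E n → ℝ) : Prop :=
  ContDiffOn ℝ 2 Φ X ∧ ∀ p, IsCriticalPoint X Φ p → (hessian Φ p).det ≠ 0

/-- The class `(C1)^k(X, ℝ)`: `C^k` functions without critical points. -/
def ClassC1 {n : ℕ} (k : ℕ∞) (X : Set (E n)) (Φ : E n → ℝ) : Prop :=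
  ContDiffOn ℝ k Φ X ∧ ∀ x ∈ X, gradient Φ x ≠ 0

/-- The class `(C2)^k(X, ℝ)`: `C^k` functions with at least one critical point, all of whose
critical points are non-degenerate. -/
def ClassC2 {n : ℕ} (k : ℕ∞) (X : Set (E n)) (Φ : E n → ℝ) : Prop :=
  ContDiffOn ℝ k Φ X ∧ (∃ p, IsCriticalPoint X Φ p) ∧
    ∀ q, IsCriticalPoint X Φ q → (hessian Φ q).det ≠ 0

/-! ### The initial value problem `h' = f(t, h)`, `h(0) = a` -/

/-- `f ∈ C^{0,k}(Ωt × Ωh, ℝᵐ)`: for each `t`, the map `f(t, ·)` is `C^k`, and `f` as well as its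
derivatives of order at most `k` in the second variable are continuous in `(t, y)`. -/
def IsC0k {m : ℕ} (k : ℕ∞) (Ωt : Set ℝ) (Ωh : Set (E m)) (f : ℝ → E m → E m) : Prop :=
  (∀ t ∈ Ωt, ContDiffOn ℝ k (f t) Ωh) ∧
    ∀ j : ℕ, (j : ℕ∞) ≤ k →
      ContinuousOn (fun p : ℝ × E m => iteratedFDeriv ℝ j (f p.1) p.2) (Ωt ×ˢ Ωh)

/-- `h` solves the initial value problem with initial value `a` on the open interval `I ∋ 0`. -/
structure IsSolution {m : ℕ} (Ωt : Set ℝ) (Ωh : Set (E m)) (f : ℝ → E m → E m) (a : E m)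
    (I : Set ℝ) (h : ℝ → E m) : Prop where
  isOpen : IsOpen I
  isPreconnected : IsPreconnected I
  zero_mem : (0 : ℝ) ∈ I
  subset : I ⊆ Ωt
  init : h 0 = a
  mem : ∀ t ∈ I, h t ∈ Ωh
  hasDerivAt : ∀ t ∈ I, HasDerivAt h (f t (h t)) t

/-- The maximal interval of existence `I_a` of the solution with initial value `a`. -/
def maxInterval {m : ℕ} (Ωt : Set ℝ) (Ωh : Set (E m)) (f : ℝ → E m → E m) (a : E m) : Set ℝ :=
  ⋃₀ {I | ∃ h, IsSolution Ωt Ωh f a I h}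

open Classical in
/-- The value `h_a(t)`, for `t` in the maximal interval of existence, of the solution with initial
value `a`. (For `f ∈ C^{0,1}` any two solutions agree where both are defined, so that the choice
is immaterial; outside the maximal interval the value is a dummy.) -/
def flow {m : ℕ} (Ωt : Set ℝ) (Ωh : Set (E m)) (f : ℝ → E m → E m) (a : E m) (t : ℝ) : E m :=
  if H : ∃ y : E m, ∃ I h, IsSolution Ωt Ωh f a I h ∧ t ∈ I ∧ h t = y then H.choose else 0

/-! ### Weights and biases -/

/-- The parameter space `𝕍 = ℝ^{m×n} × ℝ^{1×m} × ℝᵐ × ℝ` of weights and biases. -/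
structure Params (n m : ℕ) where
  W : Matrix (Fin m) (Fin n) ℝ
  Wt : Matrix (Fin 1) (Fin m) ℝ
  b : E m
  bt : ℝ

/-- Labels of the `N_V = mn + 2m + 1` scalar entries of `(W, W̃, b, b̃)`. -/
abbrev ParamIdx (n m : ℕ) : Type :=
  (Fin m × Fin n) ⊕ (Fin 1 × Fin m) ⊕ Fin m ⊕ Unit

theorem card_paramIdx (n m : ℕ) : Fintype.card (ParamIdx n m) = m * n + 2 * m + 1 := by
  simp [ParamIdx]; ring

/-- Vectorization `𝕍 → ℝ^{N_V}`: the list of all entries of the weights and biases. -/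
def vecm {n m : ℕ} (V : Params n m) : ParamIdx n m → ℝ
  | .inl (i, j) => V.W i j
  | .inr (.inl (i, j)) => V.Wt i j
  | .inr (.inr (.inl i)) => V.b i
  | .inr (.inr (.inr _)) => V.bt

theorem vecm_bijective (n m : ℕ) : Function.Bijective (vecm (n := n) (m := m)) := by
  constructor
  · rintro ⟨W, Wt, b, bt⟩ ⟨W', Wt', b', bt'⟩ h
    have h1 : W = W' := by
      ext i j; exact congrFun h (.inl (i, j))
    have h2 : Wt = Wt' := by
      ext i j; exact congrFun h (.inr (.inl (i, j)))
    have h3 : b = b' := by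
      ext i; exact congrFun h (.inr (.inr (.inl i)))
    have h4 : bt = bt' := congrFun h (.inr (.inr (.inr ())))
    subst h1 h2 h3 h4; rfl
  · intro v
    refine ⟨⟨Matrix.of fun i j => v (.inl (i, j)), Matrix.of fun i j => v (.inr (.inl (i, j))),
      WithLp.toLp 2 fun i => v (.inr (.inr (.inl i))), v (.inr (.inr (.inr ())))⟩, ?_⟩
    funext x
    rcases x with ⟨i, j⟩ | ⟨i, j⟩ | i | _ <;> rfl

/-- The inner affine layer `λ(x) = W x + b`. -/
def Params.affine {n m : ℕ} (V : Params n m) (x : E n) : E m :=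
  WithLp.toLp 2 (V.W.mulVec x.ofLp) + V.b

/-- The outer affine layer `λ̃(y) = W̃ y + b̃`. -/
def Params.outer {n m : ℕ} (V : Params n m) (y : E m) : ℝ :=
  V.Wt.mulVec y.ofLp 0 + V.bt

/-! ### Neural ODEs -/

/-- The input-output map `Φ(x) = W̃ h_{Wx+b}(T) + b̃`. -/
def nodeMap {n m : ℕ} (Ωt : Set ℝ) (Ωh : Set (E m)) (f : ℝ → E m → E m) (T : ℝ)
    (V : Params n m) (x : E n) : ℝ :=
  V.outer (flow Ωt Ωh f (V.affine x) T)

/-- The data define a scalar neural ODE of class `NODE^k(X, ℝ)`: all solutions starting in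
`λ(X)` exist at least on `[0, T]`. -/
structure IsNODE {n m : ℕ} (k : ℕ∞) (X : Set (E n)) (Ωt : Set ℝ) (Ωh : Set (E m))
    (f : ℝ → E m → E m) (T : ℝ) (V : Params n m) : Prop where
  isOpen_X : IsOpen X
  isOpen_Ωt : IsOpen Ωt
  isOpen_Ωh : IsOpen Ωh
  isC0k : IsC0k k Ωt Ωh f
  T_nonneg : 0 ≤ T
  image_subset : V.affine '' X ⊆ Ωh
  exists_solution : ∀ a ∈ V.affine '' X, Icc 0 T ⊆ maxInterval Ωt Ωh f a

/-- The data define an augmented scalar neural ODE, of class `NODE^k_A(X, ℝ)`: `n < m` and both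
weight matrices have full rank. -/
structure IsAugmentedNODE {n m : ℕ} (k : ℕ∞) (X : Set (E n)) (Ωt : Set ℝ) (Ωh : Set (E m))
    (f : ℝ → E m → E m) (T : ℝ) (V : Params n m) : Prop
    extends IsNODE k X Ωt Ωh f T V where
  lt : n < m
  rank_W : V.W.rank = n
  rank_Wt : V.Wt.rank = 1

end NeuralODE

end

/-! Let ψ be the time-`T` map a ↦ h_a(T) and w the outer weight, viewed as a vector. Then ∇Φ(x) =
A(x, v) w with A(x, v) = (Dψ(Wx + b) W)ᵀ, and A does not involve w. Wherever the neural ODE is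
defined, Dψ and W are both injective, so A(x, v) is surjective: varying w alone moves the gradient
in every direction. Parametric transversality then makes the derivative of x ↦ A(x, v) w injective
at each of its zeros, for almost every v, and this derivative is the Hessian of Φ.

The transversality statement is `exists_null_forall_fderiv_injective`. For k = 2 the map A is only
C¹, so the statement is reduced to Sard's theorem between spaces of equal dimension, which needs
mere differentiability on an arbitrary set.

The facts about ψ are `contDiffAt_flow`. As f is only continuous in t, the initial value problem is
treated as the equation h - ∫₀ f(s, h(s)) ds = a in C([α, β], ℝᵐ). The left side is C^k in h, and
its derivative is the identity minus a Volterra operator, hence invertible. The inverse function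
theorem gives smoothness in a. Injectivity of Dψ is uniqueness for the linearized equation, started
at time `T` instead of 0. -/

open scoped Topology Interval

/-! ### Parametric transversality through Sard's theorem in equal dimensions. -/

section Transversality

variable {E P F : Type*} [NormedAddCommGroup E] [NormedSpace ℝ E] [FiniteDimensional ℝ E]
  [NormedAddCommGroup P] [NormedSpace ℝ P]
  [NormedAddCommGroup F] [NormedSpace ℝ F]

/-- A right inverse of `A` can be perturbed into a dense sequence because invertibility is an open
condition. Countably many `B` therefore serve all surjective `A` at once, which reduces the null set
to a countable union. -/
theorem exists_isUnit_comp_denseSeq [FiniteDimensional ℝ F] (A : F →L[ℝ] E)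
    (hA : Function.Surjective A) :
    ∃ i, IsUnit (A ∘L TopologicalSpace.denseSeq (E →L[ℝ] F) i) := by
  obtain ⟨B, hB⟩ := (A : F →ₗ[ℝ] E).exists_rightInverse_of_surjective (LinearMap.range_eq_top.2 hA)
  have hopen : IsOpen ((fun B : E →L[ℝ] F => (A ∘L B : E →L[ℝ] E)) ⁻¹' {M | IsUnit M}) :=
    Units.isOpen.preimage (by fun_prop)
  obtain ⟨_, h, ⟨i, rfl⟩⟩ := (TopologicalSpace.denseRange_denseSeq (E →L[ℝ] F)).inter_open_nonempty
    _ hopen ⟨LinearMap.toContinuousLinearMap B, by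
      have : A ∘L LinearMap.toContinuousLinearMap B = 1 := by
        ext x; exact LinearMap.congr_fun hB x
      simp [this]⟩
  exact ⟨i, h⟩

/-- The differentiated map F solves A (w + B F) = 0. Differentiating this identity in a direction
(u, 0), which leaves w fixed, gives A'(u, 0)(w + B F) + A B F'(u, 0) = 0. -/
theorem hasFDerivAt_neg_inverse_comp_apply {A : E × P → F →L[ℝ] E} {A' : E × P →L[ℝ] F →L[ℝ] E}
    (w : P →L[ℝ] F) (B : E →L[ℝ] F) {z : E × P} (hA : HasFDerivAt A A' z)
    (hu : IsUnit (A z ∘L B)) :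
    ∃ F' : E × P →L[ℝ] E,
      HasFDerivAt (fun z => -Ring.inverse (A z ∘L B) (A z (w z.2))) F' z ∧
      ∀ u : E, F' (u, 0) = -Ring.inverse (A z ∘L B)
        (A' (u, 0) (w z.2 + B (-Ring.inverse (A z ∘L B) (A z (w z.2))))) := by
  obtain ⟨U, hU⟩ := hu
  have h1 : HasFDerivAt (fun z => A z ∘L B)
      ((ContinuousLinearMap.precomp E B) ∘L A') z :=
    (ContinuousLinearMap.precomp E B : (F →L[ℝ] E) →L[ℝ] (E →L[ℝ] E)).hasFDerivAt.comp z hA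
  have h2 := hasFDerivAt_ringInverse (𝕜 := ℝ) U
  rw [hU] at h2
  have h3 := h2.comp z h1
  have h4 : HasFDerivAt (fun z : E × P => w z.2) (w ∘L ContinuousLinearMap.snd ℝ E P) z :=
    (w ∘L ContinuousLinearMap.snd ℝ E P).hasFDerivAt
  have h5 := (h3.clm_apply (hA.clm_apply h4)).neg
  refine ⟨_, h5, fun u => ?_⟩
  simp [← hU]

/-- `C` embeds a block of parameters on which `A` does not depend and which `w` reads off. Moving p
along this block shifts `w p` freely while `A` stays fixed; this freedom turns a statement about
zeros into one about critical values. -/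
theorem exists_null_forall_fderiv_injective [FiniteDimensional ℝ P]
    [FiniteDimensional ℝ F] [MeasurableSpace E] [BorelSpace E]
    [MeasurableSpace P] [BorelSpace P] (μ : Measure P) [μ.IsAddHaarMeasure]
    (A : E × P → F →L[ℝ] E) (w : P →L[ℝ] F) (C : F →L[ℝ] P) (hwC : ∀ y, w (C y) = y)
    (hAC : ∀ x p y, A (x, p + C y) = A (x, p)) :
    ∃ N : Set P, μ N = 0 ∧ ∀ x, ∀ p ∉ N, DifferentiableAt ℝ A (x, p) →
      Function.Surjective (A (x, p)) → A (x, p) (w p) = 0 →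
      ∀ u, fderiv ℝ A (x, p) (u, 0) (w p) = 0 → u = 0 := by
  let N (i : ℕ) : Set P := {p | ∃ x, DifferentiableAt ℝ A (x, p) ∧
    IsUnit (A (x, p) ∘L TopologicalSpace.denseSeq (E →L[ℝ] F) i) ∧ A (x, p) (w p) = 0 ∧
    ∃ u ≠ 0, fderiv ℝ A (x, p) (u, 0) (w p) = 0}
  refine ⟨⋃ i, N i, measure_iUnion_null fun i => ?_, fun x p hp hd hs h0 u hu => ?_⟩
  swap
  · by_contra hne
    obtain ⟨i, hi⟩ := exists_isUnit_comp_denseSeq (A (x, p)) hs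
    exact hp (mem_iUnion.2 ⟨i, x, hd, hi, h0, u, hne, hu⟩)
  set B := TopologicalSpace.denseSeq (E →L[ℝ] F) i
  -- When `A z ∘L B` is invertible, `Fz z` is the unique c with A z (w + B c) = 0.
  let Fz (z : E × P) : E := -Ring.inverse (A z ∘L B) (A z (w z.2))
  -- By the derivative formula, these are points where the partial derivative of `Fz` in x has a
  -- kernel, so that z ↦ (Fz z, z.2) has singular derivative.
  let S : Set (E × P) := {z | DifferentiableAt ℝ A z ∧ IsUnit (A z ∘L B) ∧
    ∃ u ≠ 0, fderiv ℝ A z (u, 0) (w z.2 + B (Fz z)) = 0}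
  have key : ∀ z ∈ S, ∃ D : E × P →L[ℝ] E × P,
      HasFDerivWithinAt (fun z => (Fz z, z.2)) D S z ∧ D.det = 0 := by
    rintro z ⟨hd, hM, u, hu, hz⟩
    obtain ⟨F', hF', hF0⟩ := hasFDerivAt_neg_inverse_comp_apply w B hd.hasFDerivAt hM
    refine ⟨F'.prod (ContinuousLinearMap.snd ℝ E P), (hF'.prodMk hasFDerivAt_snd).hasFDerivWithinAt,
      ?_⟩
    rw [ContinuousLinearMap.det, ← not_ne_iff]
    intro hdet
    have hbij := (LinearMap.isUnit_iff_isUnit_det _).2 (isUnit_iff_ne_zero.2 hdet)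
    have hinj := ((Module.End.isUnit_iff _).1 hbij).1
    have : (u, (0 : P)) = 0 := hinj (by
      have h0 : F' (u, 0) = 0 := by
        rw [hF0]
        change -Ring.inverse (A z ∘L B) (fderiv ℝ A z (u, 0) (w z.2 + B (Fz z))) = 0
        rw [hz]; simp
      simp [h0])
    exact hu (by simpa using this)
  choose! D hD hdet using key
  have hnull := addHaar_image_eq_zero_of_det_fderivWithin_eq_zero
    ((Measure.addHaar : Measure E).prod μ) hD hdet
  let σ : E × P →ₗ[ℝ] E × P :=
    (LinearMap.fst ℝ E P).prod (LinearMap.snd ℝ E P + (C ∘L B).toLinearMap ∘ₗ LinearMap.fst ℝ E P)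
  -- If p is bad at x, then for every c the shifted parameter p - C (B c) satisfies Fz = c at x, so
  -- (c, p - C (B c)) is a critical value. The linear shear `σ` undoes the shift, and the whole
  -- cylinder over `N i` is covered.
  have hsub : univ ×ˢ N i ⊆ σ '' ((fun z => (Fz z, z.2)) '' S) := by
    rintro ⟨c, p⟩ ⟨-, x, hd, hM, h0, u, hu, hz⟩
    have hshift : ∀ z : E × P, A (z + (0, -C (B c))) = A z := fun z => by
      have := hAC z.1 z.2 (-B c)
      rw [map_neg] at this
      rw [← this]; congr 1; ext <;> simp
    have hq : ((x, p - C (B c)) : E × P) = (x, p) + (0, -C (B c)) := by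
      ext <;> simp [sub_eq_add_neg]
    have hA : A (x, p - C (B c)) = A (x, p) := by rw [hq, hshift]
    have hA' : HasFDerivAt A (fderiv ℝ A (x, p)) (x, p - C (B c)) := by
      have h : HasFDerivAt A (fderiv ℝ A (x, p)) ((x, p - C (B c)) + (0, C (B c))) := by
        simpa using hd.hasFDerivAt
      have h2 := h.comp (x, p - C (B c)) ((hasFDerivAt_id (𝕜 := ℝ) _).add_const _)
      refine h2.congr_of_eventuallyEq (.of_forall fun z => ?_)
      have := hshift (z + (0, C (B c)))
      rw [add_assoc] at this
      simpa [← Prod.zero_eq_mk] using this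
    have hF : Fz (x, p - C (B c)) = c := by
      have : A (x, p) (w (p - C (B c))) = -(A (x, p) ∘L B) c := by
        rw [map_sub, hwC, map_sub, h0]; simp
      change -Ring.inverse (A (x, p - C (B c)) ∘L B) (A (x, p - C (B c)) (w (p - C (B c)))) = c
      rw [hA, this, map_neg, neg_neg, ← mul_apply_eq_comp, Ring.inverse_mul_cancel _ hM]
      rfl
    refine ⟨(c, p - C (B c)), ⟨(x, p - C (B c)), ⟨hA'.differentiableAt, by rwa [hA], u, hu, ?_⟩, ?_⟩,
      ?_⟩
    · rw [hA'.fderiv, hF, map_sub, hwC]; simpa using hz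
    · simp [hF]
    · simp [σ]
  -- The cylinder is null while `E` has nonzero Haar measure, so its base `N i` is null; the product
  -- formula needs no measurability of `N i`.
  have h := measure_mono_null (μ := (Measure.addHaar : Measure E).prod μ) hsub
    (by rw [Measure.addHaar_image_linearMap, hnull, mul_zero])
  rw [Measure.prod_prod] at h
  exact (mul_eq_zero.1 h).resolve_left (NeZero.ne _)

end Transversality

/-! ### Differentiability of superposition operators on spaces of continuous maps. -/

section Nemytskii

variable {K E F : Type*} [TopologicalSpace K]
  [NormedAddCommGroup E] [NormedAddCommGroup F]

/-- The superposition (Nemytskii) operator `h ↦ f(·, h(·))`. -/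
noncomputable def nemytskii (f : K → E → F) (h : C(K, E)) : C(K, F) :=
  ContinuousMap.mkD (fun t => f t (h t)) 0

/-- Continuous maps with values in `Ω`. -/
def mapsInto (K : Type*) {E : Type*} [TopologicalSpace K] [TopologicalSpace E] (Ω : Set E) :
    Set C(K, E) :=
  {h | ∀ t, h t ∈ Ω}

theorem isOpen_mapsInto [CompactSpace K] {Ω : Set E} (hΩ : IsOpen Ω) : IsOpen (mapsInto K Ω) := by
  convert ContinuousMap.isOpen_setOfPred_mapsTo (X := K) isCompact_univ hΩ using 1
  ext h; simp [mapsInto, MapsTo]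

theorem nemytskii_apply {f : K → E → F} {Ω : Set E}
    (hf : ContinuousOn (fun p : K × E => f p.1 p.2) (univ ×ˢ Ω)) {h : C(K, E)}
    (hh : h ∈ mapsInto K Ω) (t : K) : nemytskii f h t = f t (h t) := by
  have hc : Continuous fun t => f t (h t) :=
    hf.comp_continuous (f := fun t => (t, h t)) (by fun_prop) fun t => ⟨mem_univ _, hh t⟩
  exact ContinuousMap.mkD_apply_of_continuous hc

theorem continuousOn_nemytskii [CompactSpace K] {f : K → E → F} {Ω : Set E}
    (hf : ContinuousOn (fun p : K × E => f p.1 p.2) (univ ×ˢ Ω)) :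
    ContinuousOn (nemytskii f) (mapsInto K Ω) := by
  refine ContinuousMap.continuousOn_of_continuousOn_uncurry _ ?_
  have : ContinuousOn (fun p : C(K, E) × K => f p.2 (p.1 p.2)) (mapsInto K Ω ×ˢ univ) := by
    refine hf.comp (f := fun p : C(K, E) × K => (p.2, p.1 p.2)) ?_ ?_
    · exact (continuous_snd.prodMk (by fun_prop)).continuousOn
    · exact fun p hp => ⟨mem_univ _, hp.1 _⟩
  exact this.congr fun p hp => nemytskii_apply hf hp.1 p.2

variable {G : Type*} [NormedAddCommGroup G] [NormedSpace ℝ G]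
  [CompactSpace K] [NormedSpace ℝ E] [NormedSpace ℝ F]

/-- Pointwise application of a continuous bilinear map. -/
noncomputable def pointwiseApply (K : Type*) [TopologicalSpace K] [CompactSpace K]
    (B : G →L[ℝ] E →L[ℝ] F) : C(K, G) →L[ℝ] C(K, E) →L[ℝ] C(K, F) :=
  LinearMap.mkContinuous₂
    (LinearMap.mk₂ ℝ (fun (A : C(K, G)) (δ : C(K, E)) =>
        (⟨fun t => B (A t) (δ t), by fun_prop⟩ : C(K, F)))
      (fun _ _ _ => by ext; simp) (fun _ _ _ => by ext; simp)
      (fun _ _ _ => by ext; simp) (fun _ _ _ => by ext; simp)) ‖B‖ fun A δ => by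
    refine (ContinuousMap.norm_le _ (by positivity)).2 fun t => ?_
    exact B.le_of_opNorm₂_le_of_le le_rfl (A.norm_coe_le_norm t) (δ.norm_coe_le_norm t)

@[simp]
theorem pointwiseApply_apply (B : G →L[ℝ] E →L[ℝ] F) (A : C(K, G)) (δ : C(K, E)) (t : K) :
    pointwiseApply K B A δ t = B (A t) (δ t) := rfl

/-- The mean value inequality is applied at each t along the segment from h t to h t + δ t. Sup-norm
continuity of the superposition operator of `g` makes the estimate uniform in t. -/
theorem hasFDerivAt_nemytskii {f : K → E → F} {Ω : Set E} (hΩ : IsOpen Ω)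
    (hf : ContinuousOn (fun p : K × E => f p.1 p.2) (univ ×ˢ Ω))
    {B : G →L[ℝ] E →L[ℝ] F} {g : K → E → G}
    (hd : ∀ t, ∀ y ∈ Ω, HasFDerivAt (f t) (B (g t y)) y)
    (hf' : ContinuousOn (fun p : K × E => g p.1 p.2) (univ ×ˢ Ω)) {h : C(K, E)}
    (hh : h ∈ mapsInto K Ω) :
    HasFDerivAt (nemytskii f) (pointwiseApply K B (nemytskii g h)) h := by
  rw [hasFDerivAt_iff_isLittleO_nhds_zero, Asymptotics.isLittleO_iff]
  intro ε hε
  have hc := (continuousOn_nemytskii hf').continuousAt ((isOpen_mapsInto hΩ).mem_nhds hh)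
  have hc' : ContinuousAt (fun h' => ‖B‖ * dist (nemytskii g h') (nemytskii g h)) h := by fun_prop
  have hev := (hc'.eventually_lt_const (u := ε) (by simpa using hε)).and ((isOpen_mapsInto hΩ).mem_nhds hh)
  obtain ⟨r, hr, hball⟩ := Metric.eventually_nhds_iff_ball.1 hev
  filter_upwards [Metric.ball_mem_nhds (0 : C(K, E)) hr] with δ hδ
  rw [mem_ball_zero_iff] at hδ
  refine (ContinuousMap.norm_le _ (by positivity)).2 fun t => ?_
  -- All of h + sδ stays in one ball of C(K, E), so the pointwise segments inherit both membership
  -- in `Ω` and the bound by ε.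
  have hmem : ∀ s ∈ Icc (0 : ℝ) 1, h + s • δ ∈ Metric.ball h r := fun s hs => by
    rw [mem_ball_iff_norm, add_sub_cancel_left, norm_smul, Real.norm_of_nonneg hs.1]
    exact (mul_le_of_le_one_left (norm_nonneg _) hs.2).trans_lt hδ
  have hseg : ∀ y ∈ segment ℝ (h t) (h t + δ t),
      HasFDerivAt (f t) (B (g t y)) y ∧ ‖B (g t y) - B (g t (h t))‖ ≤ ε := by
    intro y hy
    rw [segment_eq_image'] at hy
    obtain ⟨s, hs, rfl⟩ := hy
    obtain ⟨h1, h2⟩ := hball _ (hmem s hs)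
    have h2t := h2 t
    have h3 := ContinuousMap.dist_apply_le_dist (f := nemytskii g (h + s • δ))
      (g := nemytskii g h) t
    rw [nemytskii_apply hf' h2, nemytskii_apply hf' hh, dist_eq_norm] at h3
    have e : h t + s • (h t + δ t - h t) = (h + s • δ) t := by simp
    simp only [e]
    refine ⟨hd t _ h2t, ?_⟩
    rw [← map_sub]
    exact (B.le_opNorm _).trans ((mul_le_mul_of_nonneg_left h3 (norm_nonneg _)).trans h1.le)
  have hb := (convex_segment (h t) (h t + δ t)).norm_image_sub_le_of_norm_hasFDerivWithin_le'
    (f := f t) (f' := fun y => B (g t y)) (φ := B (g t (h t))) (C := ε)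
    (fun y hy => (hseg y hy).1.hasFDerivWithinAt)
    (fun y hy => (hseg y hy).2) (left_mem_segment _ _ _) (right_mem_segment _ _ _)
  have hhδ : h + δ ∈ mapsInto K Ω := by
    have := (hball _ (hmem 1 (by simp))).2
    rwa [one_smul] at this
  simp only [ContinuousMap.sub_apply, pointwiseApply_apply, nemytskii_apply hf hhδ, nemytskii_apply hf hh,
    nemytskii_apply hf' hh, ContinuousMap.add_apply]
  rw [add_sub_cancel_left] at hb
  exact hb.trans (mul_le_mul_of_nonneg_left (δ.norm_coe_le_norm t) hε.le)

theorem contDiffOn_nemytskii_succ {f : K → E → F} {Ω : Set E} (hΩ : IsOpen Ω) (k : ℕ)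
    (hf : ContinuousOn (fun p : K × E => f p.1 p.2) (univ ×ˢ Ω))
    {B : G →L[ℝ] E →L[ℝ] F} {g : K → E → G}
    (hd : ∀ t, ∀ y ∈ Ω, HasFDerivAt (f t) (B (g t y)) y)
    (hg : ContinuousOn (fun p : K × E => g p.1 p.2) (univ ×ˢ Ω))
    (hN : ContDiffOn ℝ k (nemytskii g) (mapsInto K Ω)) :
    ContDiffOn ℝ (k + 1) (nemytskii f) (mapsInto K Ω) := by
  have hder : ∀ h ∈ mapsInto K Ω, HasFDerivAt (nemytskii f)
      (pointwiseApply K B (nemytskii g h)) h := fun h hh => hasFDerivAt_nemytskii hΩ hf hd hg hh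
  rw [contDiffOn_succ_iff_fderiv_of_isOpen (isOpen_mapsInto hΩ)]
  refine ⟨fun h hh => (hder h hh).differentiableAt.differentiableWithinAt, by simp, ?_⟩
  exact ((pointwiseApply K B).contDiff.comp_contDiffOn hN).congr fun h hh => (hder h hh).fderiv

theorem continuousOn_of_iteratedFDeriv_zero {X : Type*} [TopologicalSpace X] {f : X → E → F}
    {s : Set (X × E)} (h : ContinuousOn (fun p : X × E => iteratedFDeriv ℝ 0 (f p.1) p.2) s) :
    ContinuousOn (fun p : X × E => f p.1 p.2) s :=
  ((ContinuousMultilinearMap.apply ℝ (fun _ : Fin 0 => E) F 0).continuous.comp_continuousOn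
    h).congr fun p _ => by simp

theorem continuousOn_iteratedFDeriv_fderiv {X : Type*} [TopologicalSpace X] {f : X → E → F}
    {s : Set (X × E)} {j : ℕ}
    (h : ContinuousOn (fun p : X × E => iteratedFDeriv ℝ (j + 1) (f p.1) p.2) s) :
    ContinuousOn (fun p : X × E => iteratedFDeriv ℝ j (fun y => fderiv ℝ (f p.1) y) p.2) s := by
  refine ((continuousMultilinearCurryRightEquiv' ℝ j E F).continuous.comp_continuousOn
    h).congr fun p _ => ?_
  simp [iteratedFDeriv_succ_eq_comp_right]

/-- Induction on k: the derivative is multiplication by the superposition operator of `fderiv ℝ (f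
t)`. The target thus changes from `F` to `E →L[ℝ] F`, so `F` is generalized. -/
theorem contDiffOn_nemytskii_nat {K E F : Type} [TopologicalSpace K] [CompactSpace K]
    [NormedAddCommGroup E] [NormedSpace ℝ E] [NormedAddCommGroup F] [NormedSpace ℝ F]
    (k : ℕ) {f : K → E → F} {Ω : Set E} (hΩ : IsOpen Ω)
    (hd : ∀ t, ContDiffOn ℝ k (f t) Ω)
    (hf : ∀ j ≤ k, ContinuousOn (fun p : K × E => iteratedFDeriv ℝ j (f p.1) p.2) (univ ×ˢ Ω)) :
    ContDiffOn ℝ k (nemytskii f) (mapsInto K Ω) := by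
  have h0 := continuousOn_of_iteratedFDeriv_zero (hf 0 (Nat.zero_le _))
  induction k generalizing F with
  | zero => exact contDiffOn_zero.2 (continuousOn_nemytskii h0)
  | succ k ih =>
    have hf1 : ∀ j ≤ k, ContinuousOn
        (fun p : K × E => iteratedFDeriv ℝ j (fun y => fderiv ℝ (f p.1) y) p.2) (univ ×ˢ Ω) :=
      fun j hj => continuousOn_iteratedFDeriv_fderiv (hf (j + 1) (by omega))
    have h1 := continuousOn_of_iteratedFDeriv_zero (f := fun t => fderiv ℝ (f t))
      (hf1 0 (Nat.zero_le _))
    push_cast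
    refine contDiffOn_nemytskii_succ hΩ k h0 (B := ContinuousLinearMap.id ℝ (E →L[ℝ] F))
      (fun t y hy => (((hd t).contDiffAt (hΩ.mem_nhds hy)).differentiableAt (by simp)).hasFDerivAt)
      h1 (ih (fun t => ?_) hf1 h1)
    have := hd t
    rw [Nat.cast_add, Nat.cast_one, contDiffOn_succ_iff_fderiv_of_isOpen hΩ] at this
    exact this.2.2

theorem contDiffOn_nemytskii {K E F : Type} [TopologicalSpace K] [CompactSpace K]
    [NormedAddCommGroup E] [NormedSpace ℝ E] [NormedAddCommGroup F] [NormedSpace ℝ F]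
    (k : ℕ∞) {f : K → E → F} {Ω : Set E} (hΩ : IsOpen Ω)
    (hd : ∀ t, ContDiffOn ℝ k (f t) Ω)
    (hf : ∀ j : ℕ, (j : ℕ∞) ≤ k →
      ContinuousOn (fun p : K × E => iteratedFDeriv ℝ j (f p.1) p.2) (univ ×ˢ Ω)) :
    ContDiffOn ℝ k (nemytskii f) (mapsInto K Ω) :=
  contDiffOn_iff_forall_nat_le.2 fun j hj =>
    contDiffOn_nemytskii_nat j hΩ (fun t => (hd t).of_le (by exact_mod_cast hj))
      fun i hi => hf i (le_trans (by exact_mod_cast hi) hj)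

end Nemytskii

/-! ### Invertibility of the identity minus a Volterra operator. -/

section Volterra

variable {E : Type*} [NormedAddCommGroup E] [NormedSpace ℝ E]
  {G : Type*} [NormedAddCommGroup G] [NormedSpace ℝ G] {α β : ℝ}

/-- The integral operator `g ↦ ∫_c^· g` on continuous maps on `[α, β]`. -/
noncomputable def primitiveCLM (E : Type*) [NormedAddCommGroup E] [NormedSpace ℝ E]
    (hαβ : α ≤ β) (c : ℝ) : C(Icc α β, E) →L[ℝ] C(Icc α β, E) :=
  LinearMap.mkContinuousOfExistsBound
    { toFun := fun g =>
        ⟨fun t => ∫ s in c..t, IccExtend hαβ g s, by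
          have : Continuous fun t : ℝ => ∫ s in c..t, IccExtend hαβ g s :=
            intervalIntegral.continuous_primitive
              (fun _ _ => (g.continuous.Icc_extend' (h := hαβ)).intervalIntegrable _ _) _
          exact this.comp continuous_subtype_val⟩
      map_add' := fun g g' => by
        ext t
        exact intervalIntegral.integral_add
          ((g.continuous.Icc_extend' (h := hαβ)).intervalIntegrable _ _)
          ((g'.continuous.Icc_extend' (h := hαβ)).intervalIntegrable _ _)
      map_smul' := fun r g => by
        ext t
        exact intervalIntegral.integral_smul _ _ }
    ⟨|c - α| + |β - α|, fun g => by
      refine (ContinuousMap.norm_le _ (by positivity)).2 fun t => ?_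
      refine (intervalIntegral.norm_integral_le_of_norm_le_const
        (fun s _ => g.norm_coe_le_norm (projIcc α β hαβ s))).trans ?_
      rw [mul_comm]
      gcongr
      have h1 := abs_sub_abs_le_abs_sub (t - α) (c - α)
      have h2 : |(t : ℝ) - α| ≤ |β - α| := by
        rw [abs_of_nonneg (sub_nonneg.2 t.2.1), abs_of_nonneg (sub_nonneg.2 hαβ)]
        linarith [t.2.2]
      calc |(t : ℝ) - c| = |(t - α) - (c - α)| := by ring_nf
        _ ≤ |(t : ℝ) - α| + |c - α| := abs_sub _ _
        _ ≤ _ := by linarith⟩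

theorem primitiveCLM_apply (hαβ : α ≤ β) (c : ℝ) (g : C(Icc α β, E)) (t : Icc α β) :
    primitiveCLM E hαβ c g t = ∫ s in c..t, IccExtend hαβ g s := rfl

/-- The geometric sum factors 1 - Vⁿ into commuting factors, one of which is 1 - V. -/
theorem isUnit_one_sub_of_norm_pow_lt_one {X : Type*} [NormedAddCommGroup X] [NormedSpace ℝ X]
    [CompleteSpace X] {V : X →L[ℝ] X} {n : ℕ} (h : ‖V ^ n‖ < 1) : IsUnit (1 - V) := by
  have hu : IsUnit (1 - V ^ n) := isUnit_one_sub_of_norm_lt_one h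
  have hcomm : Commute (1 - V) (∑ i ∈ Finset.range n, V ^ i) :=
    (mul_neg_geom_sum V n).trans (geom_sum_mul_neg V n).symm
  rw [← mul_neg_geom_sum, hcomm.isUnit_mul_iff] at hu
  exact hu.1

/-- Each iteration integrates |s - c|ⁿ once more; this produces the factorial. Absolute values allow
`t` on either side of `c`. -/
theorem norm_volterra_pow_apply_le (hαβ : α ≤ β) {c : ℝ} (hc : c ∈ Icc α β)
    (B : G →L[ℝ] E →L[ℝ] E) (A : C(Icc α β, G)) (n : ℕ) (g : C(Icc α β, E)) (t : Icc α β) :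
    ‖((primitiveCLM E hαβ c ∘L pointwiseApply (Icc α β) B A) ^ n) g t‖ ≤
      (‖B‖ * ‖A‖) ^ n * |t - c| ^ n / n.factorial * ‖g‖ := by
  induction n generalizing t with
  | zero => simpa using g.norm_coe_le_norm t
  | succ n ih =>
    rw [pow_succ', mul_apply_eq_comp, ContinuousLinearMap.comp_apply, primitiveCLM_apply]
    set G := ((primitiveCLM E hαβ c ∘L pointwiseApply (Icc α β) B A) ^ n) g
    have hb : ∀ s ∈ Ι c (t : ℝ), ‖IccExtend hαβ (pointwiseApply (Icc α β) B A G) s‖ ≤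
        (‖B‖ * ‖A‖) ^ (n + 1) / n.factorial * ‖g‖ * |s - c| ^ n := by
      intro s hs
      have hs' : s ∈ Icc α β := uIcc_subset_Icc hc t.2 (uIoc_subset_uIcc hs)
      rw [IccExtend_of_mem _ _ hs', pointwiseApply_apply]
      refine (B.le_of_opNorm₂_le_of_le le_rfl (A.norm_coe_le_norm _) (ih ⟨s, hs'⟩)).trans
        (le_of_eq ?_)
      simp only; ring
    have hi : IntervalIntegrable
        (fun s : ℝ => (‖B‖ * ‖A‖) ^ (n + 1) / n.factorial * ‖g‖ * |s - c| ^ n) volume c t :=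
      (by fun_prop : Continuous _).intervalIntegrable _ _
    refine (intervalIntegral.norm_integral_le_integral_norm_uIoc).trans ?_
    refine (setIntegral_mono_on ?_ hi.def' measurableSet_uIoc hb).trans (le_of_eq ?_)
    · exact (((pointwiseApply (Icc α β) B A G).continuous.Icc_extend' (h := hαβ)).norm.intervalIntegrable
        c t).def'
    · rw [integral_const_mul, integral_pow_abs_sub_uIoc, Nat.factorial_succ]
      push_cast
      field_simp

theorem isUnit_one_sub_volterra [CompleteSpace E] (hαβ : α ≤ β) {c : ℝ} (hc : c ∈ Icc α β)
    (B : G →L[ℝ] E →L[ℝ] E) (A : C(Icc α β, G)) :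
    IsUnit (1 - primitiveCLM E hαβ c ∘L pointwiseApply (Icc α β) B A) := by
  set V := primitiveCLM E hαβ c ∘L pointwiseApply (Icc α β) B A
  -- Factorials beat powers: some iterate has norm below 1, however long the interval.
  obtain ⟨n, hn⟩ := ((FloorSemiring.tendsto_pow_div_factorial_atTop
    ((‖B‖ * ‖A‖) * (β - α))).eventually_lt_const zero_lt_one).exists
  have hV : ‖V ^ n‖ < 1 := by
    refine (ContinuousLinearMap.opNorm_le_bound _ ?_ fun g => ?_).trans_lt hn
    · have := sub_nonneg.2 hαβ
      positivity
    · refine (ContinuousMap.norm_le _ ?_).2 fun t => ?_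
      · have := sub_nonneg.2 hαβ
        positivity
      · refine (norm_volterra_pow_apply_le hαβ hc B A n g t).trans ?_
        rw [mul_pow (‖B‖ * ‖A‖) (β - α)]
        gcongr
        rw [abs_le]; constructor <;> linarith [t.2.1, t.2.2, hc.1, hc.2]
  exact isUnit_one_sub_of_norm_pow_lt_one hV

end Volterra

/-! ### The integral equation and the inverse function theorem. -/

section IntegralEquation

variable {E : Type*} [NormedAddCommGroup E] [NormedSpace ℝ E] [CompleteSpace E]
  {G : Type*} [NormedAddCommGroup G] [NormedSpace ℝ G] {α β : ℝ}

/-- A solution of a linear Volterra equation that vanishes somewhere is zero. -/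
theorem eq_zero_of_linear_volterra (hαβ : α ≤ β) {c τ : ℝ} (hτ : τ ∈ Icc α β)
    (B : G →L[ℝ] E →L[ℝ] E) (A : C(Icc α β, G)) {y : C(Icc α β, E)} {δ : E}
    (hy : y - primitiveCLM E hαβ c (pointwiseApply (Icc α β) B A y) = ContinuousMap.const _ δ)
    (h0 : y ⟨τ, hτ⟩ = 0) : δ = 0 := by
  have happ : ∀ t : Icc α β, y t - ∫ s in c..t, IccExtend hαβ (pointwiseApply (Icc α β) B A y) s
      = δ := fun t => DFunLike.congr_fun hy t
  have hint : ∀ a b, IntervalIntegrable (IccExtend hαβ (pointwiseApply (Icc α β) B A y)) volume a b :=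
    fun a b => (ContinuousMap.continuous _).Icc_extend'.intervalIntegrable _ _
  -- Subtracting the equation at τ from the one at t moves the base point to τ and removes the
  -- constant δ, because y vanishes at τ.
  have hz : (1 - primitiveCLM E hαβ τ ∘L pointwiseApply (Icc α β) B A) y = 0 := by
    ext t
    change y t - ∫ s in τ..t, IccExtend hαβ (pointwiseApply (Icc α β) B A y) s = 0
    have h1 := happ t
    rw [← happ ⟨τ, hτ⟩, h0] at h1
    have h2 := intervalIntegral.integral_interval_sub_left (hint c t) (hint c τ)
    rw [← h2, ← sub_add, h1]
    simp
  obtain ⟨u, hu⟩ := isUnit_one_sub_volterra hαβ hτ B A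
  rw [← hu] at hz
  have hy0 : y = 0 := (ContinuousLinearEquiv.ofUnit u).injective (hz.trans (map_zero _).symm)
  have := happ ⟨τ, hτ⟩
  simpa [hy0, IccExtend, Function.comp_def] using this.symm

/-- Smooth dependence on the initial value of solutions of the integral equation. -/
theorem exists_contDiffAt_solution (hαβ : α ≤ β) (h0αβ : (0 : ℝ) ∈ Icc α β)
    {f : Icc α β → E → E} {Ω : Set E} (hΩ : IsOpen Ω) {k : WithTop ℕ∞} (hk : k ≠ 0)
    (hN : ContDiffOn ℝ k (nemytskii f) (mapsInto (Icc α β) Ω))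
    (hf : ContinuousOn (fun p : Icc α β × E => f p.1 p.2) (univ ×ˢ Ω))
    {B : G →L[ℝ] E →L[ℝ] E} {g : Icc α β → E → G}
    (hd : ∀ t, ∀ y ∈ Ω, HasFDerivAt (f t) (B (g t y)) y)
    (hg : ContinuousOn (fun p : Icc α β × E => g p.1 p.2) (univ ×ˢ Ω))
    {a₀ : E} {h₀ : C(Icc α β, E)} (hh₀ : h₀ ∈ mapsInto (Icc α β) Ω)
    (hs : h₀ - primitiveCLM E hαβ 0 (nemytskii f h₀) = ContinuousMap.const _ a₀) :
    ∃ Q : E → C(Icc α β, E), ContDiffAt ℝ k Q a₀ ∧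
      (∀ᶠ a in 𝓝 a₀, Q a ∈ mapsInto (Icc α β) Ω ∧
        Q a - primitiveCLM E hαβ 0 (nemytskii f (Q a)) = ContinuousMap.const _ a) ∧
      ∀ δ, fderiv ℝ Q a₀ δ - primitiveCLM E hαβ 0 (pointwiseApply (Icc α β) B (nemytskii g h₀)
        (fderiv ℝ Q a₀ δ)) = ContinuousMap.const _ δ := by
  let Pi (h : C(Icc α β, E)) : C(Icc α β, E) := h - primitiveCLM E hαβ 0 (nemytskii f h)
  have hnhds := (isOpen_mapsInto hΩ).mem_nhds hh₀
  have hP : ContDiffAt ℝ k Pi h₀ :=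
    contDiffAt_id.sub ((primitiveCLM E hαβ 0).contDiff.contDiffAt.comp h₀ (hN.contDiffAt hnhds))
  obtain ⟨u, hu⟩ := isUnit_one_sub_volterra hαβ h0αβ B (nemytskii g h₀)
  have hP' : HasFDerivAt Pi (ContinuousLinearEquiv.ofUnit u : C(Icc α β, E) →L[ℝ] C(Icc α β, E))
      h₀ := by
    have e : (ContinuousLinearEquiv.ofUnit u : C(Icc α β, E) →L[ℝ] C(Icc α β, E)) =
      1 - primitiveCLM E hαβ 0 ∘L pointwiseApply (Icc α β) B (nemytskii g h₀) := hu
    rw [e]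
    exact (hasFDerivAt_id h₀).sub
      ((primitiveCLM E hαβ 0).hasFDerivAt.comp h₀ (hasFDerivAt_nemytskii hΩ hf hd hg hh₀))
  let c : E →L[ℝ] C(Icc α β, E) :=
    LinearMap.mkContinuous ⟨⟨fun a => ContinuousMap.const _ a, fun _ _ => rfl⟩, fun _ _ => rfl⟩ 1
      fun a => (ContinuousMap.norm_le _ (by positivity)).2 fun t => by rw [one_mul]; exact le_rfl
  have hPc : Pi h₀ = c a₀ := hs
  -- The local inverse of `Pi`, restricted to constant right-hand sides, is the solution as a
  -- function of its initial value.
  let R := hP.localInverse hP' hk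
  have hR : ContDiffAt ℝ k R (c a₀) := hPc ▸ hP.to_localInverse hP' hk
  have hR0 : R (c a₀) = h₀ := hPc ▸ hP.localInverse_apply_image hP' hk
  have hQ : ContDiffAt ℝ k (fun a => R (c a)) a₀ := hR.comp a₀ c.contDiff.contDiffAt
  have hev1 : ∀ᶠ x in 𝓝 (c a₀), Pi (R x) = x :=
    hPc ▸ (hP.hasStrictFDerivAt' hP' hk).eventually_right_inverse
  have hev2 : ∀ᶠ a in 𝓝 a₀, Pi (R (c a)) = c a := c.continuous.continuousAt.eventually hev1
  refine ⟨fun a => R (c a), hQ, ?_, fun δ => ?_⟩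
  · have hmem : ∀ᶠ a in 𝓝 a₀, R (c a) ∈ mapsInto (Icc α β) Ω :=
      hQ.continuousAt.eventually_mem (by simpa only [hR0] using hnhds)
    exact hmem.and hev2
  -- Differentiating Pi (R (c a)) = c a yields the linearized Volterra equation.
  · have h1 : HasFDerivAt (fun a => Pi (R (c a))) c a₀ :=
      c.hasFDerivAt.congr_of_eventuallyEq hev2
    have h2 := (hR0.symm ▸ hP' : HasFDerivAt Pi _ (R (c a₀))).comp a₀
      (hQ.differentiableAt hk).hasFDerivAt
    have h3 := DFunLike.congr_fun (h2.unique h1) δ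
    rw [ContinuousLinearMap.comp_apply] at h3
    have e : ∀ v, (ContinuousLinearEquiv.ofUnit u : C(Icc α β, E) →L[ℝ] C(Icc α β, E)) v =
      v - primitiveCLM E hαβ 0 (pointwiseApply (Icc α β) B (nemytskii g h₀) v) :=
        fun v => DFunLike.congr_fun hu v
    rw [e] at h3
    exact h3

end IntegralEquation

/-! ### Uniqueness, and regularity of the time-`T` map. -/

namespace NeuralODE

variable {m : ℕ} {Ωt : Set ℝ} {Ωh : Set (E m)} {f : ℝ → E m → E m} {k : ℕ∞}

theorem IsC0k.continuousOn (hf : IsC0k k Ωt Ωh f) :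
    ContinuousOn (fun p : ℝ × E m => f p.1 p.2) (Ωt ×ˢ Ωh) :=
  continuousOn_of_iteratedFDeriv_zero (hf.2 0 (by simp))

theorem IsC0k.continuousOn_fderiv (hf : IsC0k k Ωt Ωh f) (hk : 1 ≤ k) :
    ContinuousOn (fun p : ℝ × E m => fderiv ℝ (f p.1) p.2) (Ωt ×ˢ Ωh) :=
  continuousOn_of_iteratedFDeriv_zero (f := fun t => fderiv ℝ (f t))
    (continuousOn_iteratedFDeriv_fderiv (hf.2 1 (by simpa using hk)))

theorem IsC0k.differentiableAt (hf : IsC0k k Ωt Ωh f) (hk : 1 ≤ k) (hΩh : IsOpen Ωh) {t : ℝ}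
    (ht : t ∈ Ωt) {y : E m} (hy : y ∈ Ωh) : DifferentiableAt ℝ (f t) y :=
  ((hf.1 t ht).contDiffAt (hΩh.mem_nhds hy)).differentiableAt (by
    have : k ≠ 0 := by rintro rfl; simp at hk
    exact_mod_cast this)

/-- Two solutions that meet agree nearby. -/
theorem IsSolution.eventuallyEq (hf : IsC0k k Ωt Ωh f) (hk : 1 ≤ k) (hΩt : IsOpen Ωt)
    (hΩh : IsOpen Ωh) {a a' : E m} {I I' : Set ℝ} {h h' : ℝ → E m}
    (hs : IsSolution Ωt Ωh f a I h) (hs' : IsSolution Ωt Ωh f a' I' h') {t₀ : ℝ} (ht : t₀ ∈ I)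
    (ht' : t₀ ∈ I') (heq : h t₀ = h' t₀) : h =ᶠ[𝓝 t₀] h' := by
  have hmem : Ωt ×ˢ Ωh ∈ 𝓝 (t₀, h t₀) :=
    (hΩt.prod hΩh).mem_nhds ⟨hs.subset ht, hs.mem _ ht⟩
  have hc := ((hf.continuousOn_fderiv hk).continuousAt hmem).norm
  -- By joint continuity, `L` bounds the derivative in y on a whole ball around (t₀, h t₀), and so
  -- is a Lipschitz constant uniform in t.
  obtain ⟨L, hL⟩ := exists_gt ‖fderiv ℝ (f t₀) (h t₀)‖
  have hL0 : 0 ≤ L := (norm_nonneg _).trans hL.le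
  obtain ⟨r, hr, hball⟩ := Metric.eventually_nhds_iff_ball.1
    ((hc.eventually_lt_const hL).and (Filter.eventually_mem_set.2 hmem))
  rw [← ball_prod_same] at hball
  have hcont : ∀ {a I h}, IsSolution Ωt Ωh f a I h → t₀ ∈ I →
      ∀ {y}, h t₀ = y → ∀ᶠ t in 𝓝 t₀, HasDerivAt h (f t (h t)) t ∧ h t ∈ Metric.ball y r := by
    rintro a I h hs ht y rfl
    filter_upwards [hs.isOpen.mem_nhds ht, (hs.hasDerivAt _ ht).continuousAt.eventually_mem
      (Metric.ball_mem_nhds _ hr)] with t h1 h2 using ⟨hs.hasDerivAt t h1, h2⟩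
  refine ODE_solution_unique_of_eventually (v := f) (K := L.toNNReal)
    (s := fun _ => Metric.ball (h t₀) r) ?_ (hcont hs ht rfl) (hcont hs' ht' heq.symm) heq
  filter_upwards [Metric.ball_mem_nhds t₀ hr] with t htr
  refine (convex_ball _ _).lipschitzOnWith_of_nnnorm_fderiv_le (𝕜 := ℝ) (fun y hy => ?_)
    fun y hy => ?_
  · have := (hball (t, y) ⟨htr, hy⟩).2
    exact hf.differentiableAt hk hΩh this.1 this.2
  · have := (hball (t, y) ⟨htr, hy⟩).1.le
    rw [← NNReal.coe_le_coe, coe_nnnorm, Real.coe_toNNReal _ hL0]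
    exact this

/-- The connected set I ∩ I' is covered by two disjoint open sets: where the solutions agree
locally, and where their values differ. The first contains 0. -/
theorem IsSolution.eqOn (hf : IsC0k k Ωt Ωh f) (hk : 1 ≤ k) (hΩt : IsOpen Ωt)
    (hΩh : IsOpen Ωh) {a : E m} {I I' : Set ℝ} {h h' : ℝ → E m}
    (hs : IsSolution Ωt Ωh f a I h) (hs' : IsSolution Ωt Ωh f a I' h') :
    EqOn h h' (I ∩ I') := by
  have hpre : IsPreconnected (I ∩ I') :=
    (hs.isPreconnected.ordConnected.inter hs'.isPreconnected.ordConnected).isPreconnected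
  have hcont : ContinuousOn (fun t => h t - h' t) (I ∩ I') := fun t ht =>
    ((hs.hasDerivAt t ht.1).continuousAt.sub
      (hs'.hasDerivAt t ht.2).continuousAt).continuousWithinAt
  have hsub : I ∩ I' ⊆ {t | h =ᶠ[𝓝 t] h'} := hpre.subset_left_of_subset_union (u := {t | h =ᶠ[𝓝 t] h'})
    (v := (I ∩ I') ∩ (fun t => h t - h' t) ⁻¹' {0}ᶜ) isOpen_setOfPred_eventually_nhds
    (hcont.isOpen_inter_preimage (hs.isOpen.inter hs'.isOpen) isOpen_compl_singleton)
    (disjoint_left.2 fun t ht ht' => ht'.2 (sub_eq_zero.2 ht.self_of_nhds))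
    (fun t ht => by
      by_cases he : h t = h' t
      · exact Or.inl (hs.eventuallyEq hf hk hΩt hΩh hs' ht.1 ht.2 he)
      · exact Or.inr ⟨ht, sub_ne_zero.2 he⟩)
    ⟨0, ⟨hs.zero_mem, hs'.zero_mem⟩, hs.eventuallyEq hf hk hΩt hΩh hs' hs.zero_mem hs'.zero_mem
      (hs.init.trans hs'.init.symm)⟩
  exact fun t ht => (hsub ht).self_of_nhds

theorem flow_eq (hf : IsC0k k Ωt Ωh f) (hk : 1 ≤ k) (hΩt : IsOpen Ωt) (hΩh : IsOpen Ωh) {a : E m}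
    {I : Set ℝ} {h : ℝ → E m} (hs : IsSolution Ωt Ωh f a I h) {t : ℝ} (ht : t ∈ I) :
    flow Ωt Ωh f a t = h t := by
  have H : ∃ y : E m, ∃ I h, IsSolution Ωt Ωh f a I h ∧ t ∈ I ∧ h t = y := ⟨_, I, h, hs, ht, rfl⟩
  obtain ⟨I', h', hs', ht', he⟩ := H.choose_spec
  rw [flow, dif_pos H, ← he]
  exact hs'.eqOn hf hk hΩt hΩh hs ⟨ht', ht⟩

theorem continuousOn_restrict_Icc {α β : ℝ} (hsub : Icc α β ⊆ Ωt) {F : Type*} [TopologicalSpace F]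
    {g : ℝ → E m → F} (hg : ContinuousOn (fun p : ℝ × E m => g p.1 p.2) (Ωt ×ˢ Ωh)) :
    ContinuousOn (fun p : Icc α β × E m => g p.1 p.2) (univ ×ˢ Ωh) :=
  hg.comp (f := fun p : Icc α β × E m => ((p.1 : ℝ), p.2)) (by fun_prop)
    fun p hp => ⟨hsub p.1.2, hp.2⟩

/-- A solution on a neighbourhood of `[α, β]` solves the integral equation. -/
theorem IsSolution.integral_equation (hf : IsC0k k Ωt Ωh f) {α β : ℝ} (hαβ : α ≤ β)
    (h0 : (0 : ℝ) ∈ Icc α β) {a : E m} {I : Set ℝ} {h : ℝ → E m}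
    (hs : IsSolution Ωt Ωh f a I h) (hI : Icc α β ⊆ I) :
    ∃ h₀ ∈ mapsInto (Icc α β) Ωh, (∀ t : Icc α β, h₀ t = h t) ∧
      h₀ - primitiveCLM (E m) hαβ 0 (nemytskii (fun t : Icc α β => f t) h₀) =
        ContinuousMap.const _ a := by
  have hcont : ContinuousOn h (Icc α β) :=
    fun t ht => (hs.hasDerivAt t (hI ht)).continuousAt.continuousWithinAt
  let h₀ : C(Icc α β, E m) := ⟨(Icc α β).domRestrict h, hcont.domRestrict⟩
  have hmem : h₀ ∈ mapsInto (Icc α β) Ωh := fun t => hs.mem t (hI t.2)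
  refine ⟨h₀, hmem, fun t => rfl, ?_⟩
  ext1 t
  have hsub : uIcc 0 (t : ℝ) ⊆ Icc α β := uIcc_subset_Icc h0 t.2
  have heq : ∀ s ∈ uIcc 0 (t : ℝ),
      IccExtend hαβ (nemytskii (fun t : Icc α β => f t) h₀) s = f s (h s) := fun s hs' => by
    rw [IccExtend_of_mem _ _ (hsub hs'), nemytskii_apply
      (continuousOn_restrict_Icc (hI.trans hs.subset) hf.continuousOn) hmem]
    rfl
  have hint := intervalIntegral.integral_eq_sub_of_hasDerivAt
    (fun s hs' => by
      have := hs.hasDerivAt s (hI (hsub hs'))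
      rwa [← heq s hs'] at this)
    ((ContinuousMap.continuous
      (nemytskii (fun t : Icc α β => f t) h₀)).Icc_extend' (h := hαβ) |>.intervalIntegrable _ _)
  change h t - ∫ s in (0 : ℝ)..t, IccExtend hαβ (nemytskii (fun t : Icc α β => f t) h₀) s = a
  rw [hint, hs.init]
  abel

/-- A solution of the integral equation on `[α, β]` is a solution on `(α, β)`. -/
theorem isSolution_of_integral_equation (hf : IsC0k k Ωt Ωh f) {α β : ℝ} (hαβ : α ≤ β)
    (h0 : (0 : ℝ) ∈ Ioo α β) (hsub : Icc α β ⊆ Ωt) {a : E m} {h : C(Icc α β, E m)}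
    (hmem : h ∈ mapsInto (Icc α β) Ωh)
    (hs : h - primitiveCLM (E m) hαβ 0 (nemytskii (fun t : Icc α β => f t) h) =
      ContinuousMap.const _ a) :
    IsSolution Ωt Ωh f a (Ioo α β) (IccExtend hαβ h) := by
  have happ : ∀ t : Icc α β, h t =
      a + ∫ s in (0 : ℝ)..t, IccExtend hαβ (nemytskii (fun t : Icc α β => f t) h) s := fun t =>
    sub_eq_iff_eq_add.1 (DFunLike.congr_fun hs t)
  have hN : Continuous (IccExtend hαβ (nemytskii (fun t : Icc α β => f t) h)) :=
    (ContinuousMap.continuous _).Icc_extend'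
  refine ⟨isOpen_Ioo, isPreconnected_Ioo, h0, Ioo_subset_Icc_self.trans hsub, ?_,
    fun t _ => hmem _, fun t ht => ?_⟩
  · rw [IccExtend_of_mem _ _ (Ioo_subset_Icc_self h0), happ]
    simp
  · have hd := (hN.integral_hasStrictDerivAt 0 t).hasDerivAt.const_add a
    rw [IccExtend_of_mem _ _ (Ioo_subset_Icc_self ht)] at hd ⊢
    rw [nemytskii_apply (continuousOn_restrict_Icc hsub hf.continuousOn) hmem] at hd
    refine hd.congr_of_eventuallyEq ?_
    filter_upwards [Ioo_mem_nhds ht.1 ht.2] with s hs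
    rw [IccExtend_of_mem _ _ (Ioo_subset_Icc_self hs), happ]

/-- Both 0 and `T` must be interior to [α, β]: nearby solutions of the integral equation on [α, β]
solve the initial value problem only on the open interval. -/
theorem exists_Icc_subset_of_isSolution {a : E m} {I : Set ℝ} {h : ℝ → E m}
    (hs : IsSolution Ωt Ωh f a I h) {T : ℝ} (hT : T ∈ I) :
    ∃ α β, 0 ∈ Ioo α β ∧ T ∈ Ioo α β ∧ Icc α β ⊆ I := by
  have hmin : min 0 T ∈ I := by rcases min_choice 0 T with h | h <;> rw [h]; exacts [hs.zero_mem, hT]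
  have hmax : max 0 T ∈ I := by rcases max_choice 0 T with h | h <;> rw [h]; exacts [hs.zero_mem, hT]
  obtain ⟨α, hα, hαI⟩ := exists_Ioc_subset_of_mem_nhds (hs.isOpen.mem_nhds hmin) (exists_lt _)
  obtain ⟨β, hβ, hβI⟩ := exists_Ico_subset_of_mem_nhds (hs.isOpen.mem_nhds hmax) (exists_gt _)
  obtain ⟨α', h1, h2⟩ := exists_between hα
  obtain ⟨β', h3, h4⟩ := exists_between hβ
  rw [lt_min_iff] at h2
  rw [max_lt_iff] at h3
  exact ⟨α', β', ⟨h2.1, h3.1⟩, ⟨h2.2, h3.2⟩, hs.isPreconnected.ordConnected.out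
    (hαI ⟨h1, le_min h2.1.le h2.2.le⟩) (hβI ⟨max_le h3.1.le h3.2.le, h4⟩)⟩

/-- The time-`T` map is of class `C^k` with injective derivative, wherever it is defined. -/
theorem contDiffAt_flow (hf : IsC0k k Ωt Ωh f) (hk : 1 ≤ k) (hΩt : IsOpen Ωt) (hΩh : IsOpen Ωh)
    {a₀ : E m} {T : ℝ} (hT : T ∈ maxInterval Ωt Ωh f a₀) :
    ContDiffAt ℝ k (fun a => flow Ωt Ωh f a T) a₀ ∧
      Function.Injective (fderiv ℝ (fun a => flow Ωt Ωh f a T) a₀) := by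
  obtain ⟨I, ⟨h, hs⟩, hTI⟩ := hT
  obtain ⟨α, β, h0, hT, hI⟩ := exists_Icc_subset_of_isSolution hs hTI
  have hαβ : α ≤ β := (h0.1.trans h0.2).le
  have hsub : Icc α β ⊆ Ωt := hI.trans hs.subset
  have hk0 : (k : WithTop ℕ∞) ≠ 0 := by
    have : k ≠ 0 := by rintro rfl; simp at hk
    exact_mod_cast this
  obtain ⟨h₀, hmem, hh₀, hP⟩ := hs.integral_equation hf hαβ (Ioo_subset_Icc_self h0) hI
  obtain ⟨Q, hQ, hQs, hQ'⟩ := exists_contDiffAt_solution hαβ (Ioo_subset_Icc_self h0) hΩh hk0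
    (contDiffOn_nemytskii k hΩh (fun t => hf.1 t (hsub t.2))
      fun j hj => continuousOn_restrict_Icc (g := fun t y => iteratedFDeriv ℝ j (f t) y) hsub (hf.2 j hj))
    (continuousOn_restrict_Icc hsub hf.continuousOn) (B := ContinuousLinearMap.id ℝ (E m →L[ℝ] E m))
    (g := fun t y => fderiv ℝ (f t) y)
    (fun t y hy => (hf.differentiableAt hk hΩh (hsub t.2) hy).hasFDerivAt)
    (continuousOn_restrict_Icc (g := fun t y => fderiv ℝ (f t) y) hsub (hf.continuousOn_fderiv hk)) hmem hP
  let ev : C(Icc α β, E m) →L[ℝ] E m :=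
    ContinuousMap.evalCLM ℝ (⟨T, Ioo_subset_Icc_self hT⟩ : Icc α β)
  have hev : (fun a => flow Ωt Ωh f a T) =ᶠ[𝓝 a₀] fun a => ev (Q a) := by
    filter_upwards [hQs] with a ha
    rw [flow_eq hf hk hΩt hΩh (isSolution_of_integral_equation hf hαβ h0 hsub ha.1 ha.2) hT,
      IccExtend_of_mem _ _ (Ioo_subset_Icc_self hT)]
    rfl
  have hd : HasFDerivAt (fun a => ev (Q a)) (ev ∘L fderiv ℝ Q a₀) a₀ :=
    ev.hasFDerivAt.comp a₀ (hQ.differentiableAt hk0).hasFDerivAt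
  refine ⟨(ev.contDiff.contDiffAt.comp a₀ hQ).congr_of_eventuallyEq hev, ?_⟩
  -- A kernel vector δ gives a solution of the linearized equation that vanishes at `T`, which
  -- forces δ = 0.
  rw [hev.fderiv_eq, hd.fderiv, injective_iff_map_eq_zero]
  exact fun δ hδ => eq_zero_of_linear_volterra hαβ (Ioo_subset_Icc_self hT) _ _ (hQ' δ) hδ

end NeuralODE

/-! ### The gradient and Hessian of the neural ODE in terms of the weights. -/

namespace NeuralODE

/-- L*L is injective on a finite-dimensional space, hence surjective, and it factors through L*. -/
theorem adjoint_surjective_of_injective {E F : Type*} [NormedAddCommGroup E]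
    [InnerProductSpace ℝ E] [FiniteDimensional ℝ E] [NormedAddCommGroup F] [InnerProductSpace ℝ F]
    [CompleteSpace E] [CompleteSpace F] {L : E →L[ℝ] F} (hL : Function.Injective L) :
    Function.Surjective (ContinuousLinearMap.adjoint L) := by
  have h1 : Function.Injective (ContinuousLinearMap.adjoint L ∘L L) :=
    L.adjoint_comp_self_injective_iff.2 hL
  have h2 : Function.Surjective (ContinuousLinearMap.adjoint L ∘L L) :=
    LinearMap.injective_iff_surjective.1 h1
  exact Function.Surjective.of_comp h2

variable {n m : ℕ}

/-- Taking adjoints, as a continuous linear map. -/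
noncomputable def adjointCLM (n m : ℕ) : (E n →L[ℝ] E m) →L[ℝ] (E m →L[ℝ] E n) :=
  LinearMap.toContinuousLinearMap
    { toFun := fun L => ContinuousLinearMap.adjoint L
      map_add' := fun _ _ => map_add _ _ _
      map_smul' := fun r L => by simp }

/-- The inner weight matrix as a function of the vector of parameters. -/
noncomputable def innerWeight (n m : ℕ) : (ParamIdx n m → ℝ) →L[ℝ] E n →L[ℝ] E m :=
  LinearMap.toContinuousLinearMap (LinearMap.toContinuousLinearMap.toLinearMap ∘ₗ
    (Matrix.toEuclideanLin (𝕜 := ℝ) (m := Fin m) (n := Fin n)).toLinearMap ∘ₗ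
    { toFun := fun v => Matrix.of fun i j => v (.inl (i, j))
      map_add' := fun _ _ => rfl
      map_smul' := fun _ _ => rfl })

/-- The outer weight as a function of the vector of parameters. -/
noncomputable def outerWeight (n m : ℕ) : (ParamIdx n m → ℝ) →L[ℝ] E m :=
  LinearMap.toContinuousLinearMap
    { toFun := fun v => WithLp.toLp 2 fun i => v (.inr (.inl (0, i)))
      map_add' := fun _ _ => rfl
      map_smul' := fun _ _ => rfl }

/-- The inner bias as a function of the vector of parameters. -/
noncomputable def innerBias (n m : ℕ) : (ParamIdx n m → ℝ) →L[ℝ] E m :=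
  LinearMap.toContinuousLinearMap
    { toFun := fun v => WithLp.toLp 2 fun i => v (.inr (.inr (.inl i)))
      map_add' := fun _ _ => rfl
      map_smul' := fun _ _ => rfl }

/-- The vector of parameters with a given outer weight and all other entries zero. -/
noncomputable def ofOuterWeight (n m : ℕ) : E m →L[ℝ] (ParamIdx n m → ℝ) :=
  LinearMap.toContinuousLinearMap
    { toFun := fun y => Sum.elim 0 (Sum.elim (fun p => y p.2) 0)
      map_add' := fun _ _ => by ext (i | i | i) <;> simp
      map_smul' := fun _ _ => by ext (i | i | i) <;> simp }

theorem outerWeight_ofOuterWeight (y : E m) : outerWeight n m (ofOuterWeight n m y) = y := rfl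

theorem innerWeight_ofOuterWeight (y : E m) : innerWeight n m (ofOuterWeight n m y) = 0 := by
  have : (Matrix.of fun (i : Fin m) (j : Fin n) => ofOuterWeight n m y (.inl (i, j))) = 0 := by
    ext; rfl
  ext1 x
  change (Matrix.toEuclideanLin (𝕜 := ℝ)
    (Matrix.of fun i j => ofOuterWeight n m y (.inl (i, j)))) x = 0
  rw [this]; simp

theorem innerBias_ofOuterWeight (y : E m) : innerBias n m (ofOuterWeight n m y) = 0 := rfl

theorem innerWeight_vecm_apply (V : Params n m) (x : E n) :
    innerWeight n m (vecm V) x = WithLp.toLp 2 (V.W.mulVec x.ofLp) := rfl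

theorem Params.affine_eq (V : Params n m) (x : E n) :
    V.affine x = innerWeight n m (vecm V) x + innerBias n m (vecm V) := rfl

theorem Params.outer_eq (V : Params n m) (y : E m) :
    V.outer y = inner ℝ (outerWeight n m (vecm V)) y + V.bt := by
  have : V.Wt.mulVec y.ofLp 0 = inner ℝ (outerWeight n m (vecm V)) y := by
    simp only [Matrix.mulVec, dotProduct, PiLp.inner_apply]
    exact Finset.sum_congr rfl fun i _ => mul_comm _ _
  rw [Params.outer, this]

theorem innerWeight_injective {V : Params n m} (hV : V.W.rank = n) :
    Function.Injective (innerWeight n m (vecm V)) := by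
  have h1 : Function.Injective V.W.mulVecLin := by
    rw [← LinearMap.ker_eq_bot]
    have := V.W.mulVecLin.finrank_range_add_finrank_ker
    rw [← Matrix.rank, hV] at this
    simpa using this
  intro x y hxy
  rw [innerWeight_vecm_apply, innerWeight_vecm_apply] at hxy
  exact WithLp.ofLp_injective 2 (h1 (WithLp.toLp_injective 2 hxy))

/-- The Hessian is the matrix of `g'`, where `g` is the gradient. As the row index is the outer
differentiation, a left null vector of the matrix is a kernel vector of `g'`, and symmetry of second
derivatives is not needed. -/
theorem det_hessian_ne_zero {Φ : E n → ℝ} {g : E n → E n} {g' : E n →L[ℝ] E n} {p : E n}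
    (hΦ : ∀ᶠ x in 𝓝 p, ∀ u, fderiv ℝ Φ x u = inner ℝ (g x) u) (hg : HasFDerivAt g g' p)
    (hinj : ∀ u, g' u = 0 → u = 0) : (hessian Φ p).det ≠ 0 := by
  intro hdet
  obtain ⟨c, hc, hc0⟩ := Matrix.exists_vecMul_eq_zero_iff.2 hdet
  have hH : ∀ i j, hessian Φ p i j =
      inner ℝ (g' (EuclideanSpace.single i 1)) (EuclideanSpace.single j (1 : ℝ)) := fun i j => by
    have h1 : (fun y => fderiv ℝ Φ y (EuclideanSpace.single j 1)) =ᶠ[𝓝 p]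
        fun y => inner ℝ (g y) (EuclideanSpace.single j (1 : ℝ)) := hΦ.mono fun x hx => hx _
    have h2 := hg.inner ℝ (hasFDerivAt_const (EuclideanSpace.single j (1 : ℝ)) p)
    rw [hessian, Matrix.of_apply, h1.fderiv_eq, h2.fderiv]
    simp [fderivInnerCLM_apply]
  have hsum : ∑ i, c i • EuclideanSpace.single i (1 : ℝ) = WithLp.toLp 2 c := by
    ext j
    simp [Pi.single_apply]
  refine hc ?_
  have : g' (WithLp.toLp 2 c) = 0 := by
    rw [← hsum, map_sum]
    ext j
    have := congrFun hc0 j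
    simp only [Matrix.vecMul, dotProduct, hH,
      EuclideanSpace.inner_single_right] at this
    simpa using this
  exact WithLp.toLp_injective 2 (hinj _ this)

section

variable {X : Set (E n)} {Ωt : Set ℝ} {Ωh : Set (E m)} {f : ℝ → E m → E m} {k : ℕ∞} {T : ℝ}
  {V : Params n m}

theorem IsNODE.mem_maxInterval (hV : IsNODE k X Ωt Ωh f T V) {x : E n} (hx : x ∈ X) :
    T ∈ maxInterval Ωt Ωh f (V.affine x) :=
  hV.exists_solution _ (mem_image_of_mem _ hx) (right_mem_Icc.2 hV.T_nonneg)

theorem IsNODE.contDiffAt_flow (hV : IsNODE k X Ωt Ωh f T V) (hk : 1 ≤ k) {x : E n} (hx : x ∈ X) :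
    ContDiffAt ℝ k (fun a => flow Ωt Ωh f a T) (V.affine x) :=
  (NeuralODE.contDiffAt_flow hV.isC0k hk hV.isOpen_Ωt hV.isOpen_Ωh (hV.mem_maxInterval hx)).1

theorem Params.hasFDerivAt_affine (V : Params n m) (x : E n) :
    HasFDerivAt V.affine (innerWeight n m (vecm V)) x :=
  (innerWeight n m (vecm V)).hasFDerivAt.add_const _

theorem nodeMap_eq : nodeMap Ωt Ωh f T V = fun x =>
    inner ℝ (outerWeight n m (vecm V)) (flow Ωt Ωh f (V.affine x) T) + V.bt :=
  funext fun _ => V.outer_eq _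

theorem IsNODE.contDiffOn_nodeMap (hV : IsNODE k X Ωt Ωh f T V) (hk : 1 ≤ k) :
    ContDiffOn ℝ k (nodeMap Ωt Ωh f T V) X := by
  intro x hx
  rw [nodeMap_eq]
  have haff : ContDiffAt ℝ k V.affine x :=
    ((innerWeight n m (vecm V)).contDiff.add contDiff_const).contDiffAt
  exact ((contDiffAt_const.inner ℝ ((hV.contDiffAt_flow hk hx).comp x haff)).add
    contDiffAt_const).contDiffWithinAt

/-- `adjointJacobian ψ (x, v)` is the adjoint of the derivative at `x` of `x ↦ ψ (W x + b)`, where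
`W` and `b` are read off from `v`. -/
noncomputable def adjointJacobian (ψ : E m → E m) (z : E n × (ParamIdx n m → ℝ)) : E m →L[ℝ] E n :=
  adjointCLM n m
    (fderiv ℝ ψ (innerWeight n m z.2 z.1 + innerBias n m z.2) ∘L innerWeight n m z.2)

theorem IsNODE.fderiv_nodeMap (hV : IsNODE k X Ωt Ωh f T V) (hk : 1 ≤ k) {x : E n} (hx : x ∈ X)
    (u : E n) : fderiv ℝ (nodeMap Ωt Ωh f T V) x u =
      inner ℝ (adjointJacobian (fun a => flow Ωt Ωh f a T) (x, vecm V)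
        (outerWeight n m (vecm V))) u := by
  have hk0 : (k : WithTop ℕ∞) ≠ 0 := by
    have : k ≠ 0 := by rintro rfl; simp at hk
    exact_mod_cast this
  have h1 := ((hV.contDiffAt_flow hk hx).differentiableAt hk0).hasFDerivAt.comp x
    (V.hasFDerivAt_affine x)
  have h2 := ((hasFDerivAt_const (outerWeight n m (vecm V)) x).inner ℝ h1).add_const V.bt
  rw [nodeMap_eq]
  refine (DFunLike.congr_fun h2.fderiv u).trans ?_
  change _ = inner ℝ (ContinuousLinearMap.adjoint _ _) _
  rw [ContinuousLinearMap.adjoint_inner_left]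
  simp [fderivInnerCLM_apply, Params.affine_eq]

theorem differentiableAt_adjointJacobian {ψ : E m → E m} {z : E n × (ParamIdx n m → ℝ)}
    (hψ : ContDiffAt ℝ 2 ψ (innerWeight n m z.2 z.1 + innerBias n m z.2)) :
    DifferentiableAt ℝ (adjointJacobian ψ) z := by
  have h1 : DifferentiableAt ℝ (fderiv ℝ ψ) (innerWeight n m z.2 z.1 + innerBias n m z.2) :=
    (hψ.fderiv_right (m := 1) (by norm_num)).differentiableAt (by simp)
  have h2 : DifferentiableAt ℝ (fun z : E n × (ParamIdx n m → ℝ) =>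
      innerWeight n m z.2 z.1 + innerBias n m z.2) z := by fun_prop
  have h3 : DifferentiableAt ℝ (fun z : E n × (ParamIdx n m → ℝ) => innerWeight n m z.2) z := by
    fun_prop
  exact (adjointCLM n m).differentiableAt.comp z ((h1.comp z h2).clm_comp h3)

end

end NeuralODE

/-! ### Genericity of the Morse property. -/

theorem mainTheorem5 {n m : ℕ} (k : ℕ∞) (hk : 2 ≤ k)
    (X : Set (NeuralODE.E n)) (Ωt : Set ℝ) (Ωh : Set (NeuralODE.E m))
    (f : ℝ → NeuralODE.E m → NeuralODE.E m) (T : ℝ) :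
    ∃ N : Set (NeuralODE.ParamIdx n m → ℝ), MeasureTheory.volume N = 0 ∧
      ∀ V : NeuralODE.Params n m, NeuralODE.IsAugmentedNODE k X Ωt Ωh f T V →
        NeuralODE.vecm V ∉ N →
          (NeuralODE.ClassC1 k X (NeuralODE.nodeMap Ωt Ωh f T V) ∨
            NeuralODE.ClassC2 k X (NeuralODE.nodeMap Ωt Ωh f T V)) ∧
          NeuralODE.IsMorse X (NeuralODE.nodeMap Ωt Ωh f T V) := by
  open NeuralODE in
  have hk1 : 1 ≤ k := le_trans (by norm_num) hk
  have hk2 : (2 : WithTop ℕ∞) ≤ k := WithTop.coe_le_coe.2 hk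
  -- The null set is fixed before V. Dummy values of `flow` are harmless: `H` is applied only at
  -- points where differentiability and surjectivity have been verified. The free block is the outer
  -- weight, on which `adjointJacobian` does not depend.
  obtain ⟨N, hN, H⟩ := exists_null_forall_fderiv_injective
    (volume : Measure (ParamIdx n m → ℝ))
    (adjointJacobian fun a => flow Ωt Ωh f a T) (outerWeight n m) (ofOuterWeight n m)
    outerWeight_ofOuterWeight fun x v y => by
      simp [adjointJacobian, innerWeight_ofOuterWeight, innerBias_ofOuterWeight]
  refine ⟨N, hN, fun V hV hVN => ?_⟩
  have hC := hV.contDiffOn_nodeMap hk1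
  have hdet : ∀ p, IsCriticalPoint X (nodeMap Ωt Ωh f T V) p →
      (hessian (nodeMap Ωt Ωh f T V) p).det ≠ 0 := by
    rintro p ⟨hp, hgrad⟩
    have hdiff := differentiableAt_adjointJacobian (z := (p, vecm V))
      ((hV.contDiffAt_flow hk1 hp).of_le hk2)
    have hsurj : Function.Surjective
        (adjointJacobian (fun a => flow Ωt Ωh f a T) (p, vecm V)) :=
      adjoint_surjective_of_injective ((contDiffAt_flow hV.isC0k hk1 hV.isOpen_Ωt hV.isOpen_Ωh
        (hV.mem_maxInterval hp)).2.comp (innerWeight_injective hV.rank_W))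
    have hzero : adjointJacobian (fun a => flow Ωt Ωh f a T) (p, vecm V)
        (outerWeight n m (vecm V)) = 0 := by
      refine ext_inner_right ℝ fun u => ?_
      rw [← hV.fderiv_nodeMap hk1 hp, inner_zero_left]
      rw [gradient, map_eq_zero_iff _ (LinearIsometryEquiv.injective _)] at hgrad
      rw [hgrad]; rfl
    have hinj := H p _ hVN hdiff hsurj hzero
    have hg := (hdiff.hasFDerivAt.comp p
      (hasFDerivAt_prodMk_left (𝕜 := ℝ) p (vecm V))).clm_apply
        (hasFDerivAt_const (outerWeight n m (vecm V)) p)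
    refine det_hessian_ne_zero (Filter.eventually_of_mem (hV.isOpen_X.mem_nhds hp)
      fun x hx => hV.fderiv_nodeMap hk1 hx) hg fun u hu => hinj u ?_
    simpa using hu
  refine ⟨?_, hC.of_le hk2, hdet⟩
  by_cases hcrit : ∃ p, IsCriticalPoint X (nodeMap Ωt Ωh f T V) p
  · exact .inr ⟨hC, hcrit, hdet⟩
  · exact .inl ⟨hC, fun x hx h0 => hcrit ⟨x, hx, h0⟩⟩
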